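/- Let $V$ be a finite set with an even number of elements and let $(p_v)_{v\in V}$ be a family of points of the Euclidean plane $\mathbb R^2$ (so points may be repeated: $p_v=p_w$ is allowed for $v\ne w$). A perfect matching is a graph on the vertex set $V$ in which every vertex has exactly one neighbour, and its cost is the sum of the Euclidean distances $\|p_v-p_w\|$ over its edges $vw$. Let $M$ be a perfect matching of maximum cost among all perfect matchings of $V$. Then the closed discs with diameters $p_vp_w$, $vw\in M$, have a common point: $$\bigcap_{vw\in M}\left\{x\in\mathbb R^2:\ \left\|x-\tfrac{p_v+p_w}{2}\right\|\le \tfrac12\|p_v-p_w\|\right\}\ne\emptyset .$$ -/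

import Mathlib

/-!
A finite set of points of `ℝ^d` in which repetitions are allowed is a family
`p : V → EuclideanSpace ℝ (Fin d)` indexed by a finite type `V`; a graph on these points is a simple
graph on `V` (two different indices may carry the same point, and may then still be joined).
-/

namespace MaxSumMatching

variable {V : Type*} {d : ℕ}

/-- The Euclidean length of the (unordered) pair `e` of vertices placed by `p`. -/
noncomputable def edgeLength (p : V → EuclideanSpace ℝ (Fin d)) (e : Sym2 V) : ℝ :=
  Sym2.lift ⟨fun v w => dist (p v) (p w), fun v w => dist_comm (p v) (p w)⟩ e

/-- The closed ball having the segment from `p v` to `p w` as a diameter, where `e = s(v, w)`. -/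
noncomputable def inducedBall (p : V → EuclideanSpace ℝ (Fin d)) (e : Sym2 V) :
    Set (EuclideanSpace ℝ (Fin d)) :=
  Sym2.lift ⟨fun v w => Metric.closedBall (midpoint ℝ (p v) (p w)) (dist (p v) (p w) / 2),
    fun v w => by simp only [midpoint_comm (p v), dist_comm (p v)]⟩ e

open Classical in
/-- The cost of a graph: the sum of the Euclidean lengths of its edges. -/
noncomputable def cost [Fintype V] (p : V → EuclideanSpace ℝ (Fin d)) (G : SimpleGraph V) : ℝ :=
  ∑ e ∈ G.edgeFinset, edgeLength p e

/-- The closed balls induced by the edges of the graph share a common point. -/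
def IsTverbergGraph (p : V → EuclideanSpace ℝ (Fin d)) (G : SimpleGraph V) : Prop :=
  (⋂ e ∈ G.edgeSet, inducedBall p e).Nonempty

/-- The graph `G` is itself a perfect matching of its vertex set. -/
def IsPerfectMatching (G : SimpleGraph V) : Prop :=
  (⊤ : G.Subgraph).IsPerfectMatching

/-- `M` is a perfect matching of the points `p` whose cost is maximal among all perfect matchings
of these points. -/
def IsMaxSumMatching [Fintype V] (p : V → EuclideanSpace ℝ (Fin d)) (M : SimpleGraph V) : Prop :=
  IsPerfectMatching M ∧ ∀ M' : SimpleGraph V, IsPerfectMatching M' → cost p M' ≤ cost p M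

end MaxSumMatching

namespace MaxSumMatching

open scoped RealInnerProductSpace

/-! Let mᵢ, rᵢ, xᵢ be the midpoint, half-length and unit direction of the i-th edge, and let o
minimize the largest power ‖mᵢ - o‖² - rᵢ². If that maximum is at most 0, o lies in every disc.
Otherwise o is a convex combination of centres attaining the maximum
(`exists_mem_convexHull_centers`), at most three of them by Carathéodory, and rᵢ < ‖mᵢ - o‖ for
each. Exchanging endpoints among these edges then lengthens the matching, a contradiction.

Put o at the origin. Each new edge is bounded below by its projection on a unit direction, and ‖m‖(1
- ⟪x, y⟫) ≤ ⟪m, x - y⟫ when m, x, y follow each other within a half-turn. Hence re-pairing two edges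
gains if both lines ℝxᵢ, ℝxⱼ meet the segment mᵢmⱼ (`false_of_cone`), so in an optimal matching one
of these lines has mᵢ, mⱼ strictly on one side. When 0 is inside the triangle of midpoints, a line
does this for at most one pair; the three lines are thus assigned cyclically to the three pairs, and
a cyclic exchange gains (`false_of_winding`). Collinear positions fall to `false_of_opposite`. -/

/-- The Euclidean plane. -/
abbrev Plane : Type := EuclideanSpace ℝ (Fin 2)

/-! ### Vector algebra in the plane -/

/-- The signed area of the parallelogram spanned by two vectors of the plane. -/
def cross (x y : Plane) : ℝ := x 0 * y 1 - x 1 * y 0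

lemma inner_eq (x y : Plane) : ⟪x, y⟫ = x 0 * y 0 + x 1 * y 1 := by
  simp [PiLp.inner_apply, Fin.sum_univ_two, mul_comm]

lemma norm_sq_eq (x : Plane) : ‖x‖ ^ 2 = x 0 ^ 2 + x 1 ^ 2 := by
  rw [← real_inner_self_eq_norm_sq, inner_eq]; ring

lemma inner_sq_add_cross_sq (x y : Plane) : ⟪x, y⟫ ^ 2 + cross x y ^ 2 = ‖x‖ ^ 2 * ‖y‖ ^ 2 := by
  rw [inner_eq, norm_sq_eq, norm_sq_eq, cross]; ring

lemma cross_neg_right (x y : Plane) : cross x (-y) = -cross x y := by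
  simp [cross]; ring

lemma cross_swap (x y : Plane) : cross x y = -cross y x := by
  simp only [cross]; ring

lemma cross_smul_eq (m x y : Plane) : cross m x • y = cross m y • x - cross x y • m := by
  ext i
  fin_cases i <;> simp [cross] <;> ring

/-- The three-term Plücker relation. -/
lemma cross_mul_cross (a b c d : Plane) :
    cross a b * cross c d = cross c a * cross d b - cross d a * cross c b := by
  simp only [cross]; ring

lemma inner_le_norm_of_norm_eq_one {x : Plane} (hx : ‖x‖ = 1) (v : Plane) : ⟪v, x⟫ ≤ ‖v‖ := by
  simpa [hx] using real_inner_le_norm v x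

lemma inner_le_one {x y : Plane} (hx : ‖x‖ = 1) (hy : ‖y‖ = 1) : ⟪x, y⟫ ≤ 1 := by
  simpa [hx] using inner_le_norm_of_norm_eq_one hy x

/-! ### The angular inequality -/

/-- If the unit vectors `m / ‖m‖`, `x`, `y`, `-m / ‖m‖` follow each other in this order on a half
circle, then the linear functional `m - ‖m‖ • x` is larger at `x` than at `y`. -/
lemma le_inner_sub_of_smul_eq {m x y : Plane} {D P Q : ℝ} (hx : ‖x‖ = 1) (hy : ‖y‖ = 1)
    (hD : 0 < D) (hP : 0 ≤ P) (hQ : 0 ≤ Q) (h : D • y = P • x - Q • m) :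
    ‖m‖ * (1 - ⟪x, y⟫) ≤ ⟪m, x - y⟫ := by
  have h1 : D ≤ P + Q * ‖m‖ := by
    have := norm_sub_le (P • x) (Q • m)
    rw [← h] at this
    simpa [norm_smul, hx, hy, abs_of_pos hD, abs_of_nonneg hP, abs_of_nonneg hQ] using this
  have h2 : ⟪m, x⟫ ≤ ‖m‖ := inner_le_norm_of_norm_eq_one hx m
  have h3 : D * ⟪m, y⟫ = P * ⟪m, x⟫ - Q * ‖m‖ ^ 2 := by
    rw [← real_inner_smul_right, h, inner_sub_right, real_inner_smul_right, real_inner_smul_right,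
      real_inner_self_eq_norm_sq]
  have h4 : D * ⟪x, y⟫ = P - Q * ⟪m, x⟫ := by
    rw [← real_inner_smul_right, h, inner_sub_right, real_inner_smul_right, real_inner_smul_right,
      real_inner_self_eq_norm_sq, hx, real_inner_comm]
    ring
  rw [inner_sub_right]
  refine le_of_mul_le_mul_left ?_ hD
  have h5 : ‖m‖ * (D * ⟪x, y⟫) = ‖m‖ * (P - Q * ⟪m, x⟫) := by rw [h4]
  -- The product of the two slacks is exactly D times the difference of the two sides.
  nlinarith [mul_nonneg (sub_nonneg.2 h1) (sub_nonneg.2 h2)]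

/-- The orientation-independent form of `le_inner_sub_of_smul_eq`. -/
lemma le_inner_sub {m x y : Plane} {s : ℝ} (hx : ‖x‖ = 1) (hy : ‖y‖ = 1)
    (hD : 0 < s * cross m x) (hP : 0 ≤ s * cross m y) (hQ : 0 ≤ s * cross x y) :
    ‖m‖ * (1 - ⟪x, y⟫) ≤ ⟪m, x - y⟫ := by
  refine le_inner_sub_of_smul_eq hx hy hD hP hQ ?_
  rw [mul_smul, cross_smul_eq, smul_sub, mul_smul, mul_smul]

/-- `le_inner_sub` when `x`, `y` lie in the convex cone spanned by `m` and `m'`. -/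
lemma le_inner_sub_of_cone {m m' x y : Plane} {s : ℝ} (hx : ‖x‖ = 1) (hy : ‖y‖ = 1)
    (hm : 0 < s * cross m m') (hmx : 0 ≤ s * cross m x) (hmx' : 0 ≤ s * cross x m')
    (hmy : 0 ≤ s * cross m y) (hxy : 0 ≤ s * cross x y) :
    ‖m‖ * (1 - ⟪x, y⟫) ≤ ⟪m, x - y⟫ := by
  rcases hmx.lt_or_eq with h | h
  · exact le_inner_sub hx hy h hmy hxy
  -- Here x is parallel to m, and the sign conditions force x = m / ‖m‖, where equality holds.
  · have hs : s ≠ 0 := by rintro rfl; simp at hm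
    have h0 : cross m x = 0 := by
      rcases mul_eq_zero.1 h.symm with h | h
      · exact absurd h hs
      · exact h
    have e : (s * cross m m') • x = (s * cross x m') • m := by
      have := cross_smul_eq m x m'
      rw [h0, zero_smul, eq_comm, sub_eq_zero] at this
      rw [mul_smul, mul_smul, this]
    have hn : s * cross m m' = s * cross x m' * ‖m‖ := by
      have := congrArg norm e
      rwa [norm_smul, norm_smul, hx, Real.norm_of_nonneg hm.le, Real.norm_of_nonneg hmx',
        mul_one] at this
    have hmn : m = ‖m‖ • x := by
      have hne : s * cross x m' ≠ 0 := by
        intro h; rw [h, zero_mul] at hn; exact hm.ne' hn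
      refine smul_right_injective _ hne ?_
      simp only
      rw [← e, hn, smul_smul]
    have e2 : ⟪m, x - y⟫ = ‖m‖ * ⟪x, x - y⟫ := by
      conv_lhs => rw [hmn]
      rw [real_inner_smul_left]
    rw [e2, inner_sub_right, real_inner_self_eq_norm_sq, hx]
    simp

/-! ### Exchanges between two segments -/

/-- Two parallel segments. -/
lemma cross_eq_zero_of_norm_add_norm_le {u x : Plane} {R : ℝ} (hx : ‖x‖ = 1)
    (h : ‖u + R • x‖ + ‖u - R • x‖ ≤ 2 * R) : cross u x = 0 := by
  by_contra hc
  -- ‖u + t • x‖² exceeds (⟪u, x⟫ + t)² by exactly (cross u x)².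
  have key : ∀ t : ℝ, ⟪u, x⟫ + t < ‖u + t • x‖ := by
    intro t
    refine lt_of_pow_lt_pow_left₀ 2 (norm_nonneg _) ?_
    have h1 := inner_sq_add_cross_sq u x
    rw [norm_add_sq_real, real_inner_smul_right, norm_smul, mul_pow, hx, Real.norm_eq_abs, sq_abs]
    rw [hx] at h1
    have := pow_pos (abs_pos.2 hc) 2
    rw [sq_abs] at this
    nlinarith
  have h1 := key R
  have key' : R - ⟪u, x⟫ < ‖u - R • x‖ := by
    refine lt_of_pow_lt_pow_left₀ 2 (norm_nonneg _) ?_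
    have h1 := inner_sq_add_cross_sq u x
    rw [norm_sub_sq_real, real_inner_smul_right, norm_smul, mul_pow, hx, Real.norm_eq_abs, sq_abs]
    rw [hx] at h1
    have := pow_pos (abs_pos.2 hc) 2
    rw [sq_abs] at this
    nlinarith
  linarith

/-- Project the first new segment on `x` and the second on `y`. The angular inequality bounds the
left side from below by (‖m₁‖ + ‖m₂‖)(1 - ⟪x, y⟫). -/
lemma inner_sub_le_of_swap {m₁ m₂ x y : Plane} {r₁ r₂ : ℝ} (hx : ‖x‖ = 1) (hy : ‖y‖ = 1)
    (h : ‖(m₁ + r₁ • x) - (m₂ - r₂ • y)‖ + ‖(m₂ + r₂ • y) - (m₁ - r₁ • x)‖ ≤ 2 * (r₁ + r₂)) :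
    ⟪m₁, x - y⟫ + ⟪m₂, y - x⟫ ≤ (r₁ + r₂) * (1 - ⟪x, y⟫) := by
  have h1 := inner_le_norm_of_norm_eq_one hx ((m₁ + r₁ • x) - (m₂ - r₂ • y))
  have h2 := inner_le_norm_of_norm_eq_one hy ((m₂ + r₂ • y) - (m₁ - r₁ • x))
  simp only [inner_sub_left, inner_add_left, inner_sub_right, real_inner_smul_left,
    real_inner_self_eq_norm_sq, hx, hy, real_inner_comm x y] at h1 h2 ⊢
  nlinarith

/-- Two segments whose directions lie in the cone spanned by their midpoints can be improved. -/
lemma false_of_cone {m₁ m₂ x y : Plane} {r₁ r₂ : ℝ} (hx : ‖x‖ = 1) (hy : ‖y‖ = 1)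
    (h₁ : r₁ < ‖m₁‖) (h₂ : r₂ < ‖m₂‖) (hm : 0 < cross m₁ m₂)
    (hx₁ : 0 ≤ cross m₁ x) (hx₂ : 0 ≤ cross x m₂) (hy₁ : 0 ≤ cross m₁ y) (hy₂ : 0 ≤ cross y m₂)
    (h : ‖(m₁ + r₁ • x) - (m₂ - r₂ • y)‖ + ‖(m₂ + r₂ • y) - (m₁ - r₁ • x)‖ ≤ 2 * (r₁ + r₂)) :
    False := by
  have hs := cross_swap
  -- For x = y the factor 1 - ⟪x, y⟫ vanishes, so the gain must come from the strict triangle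
  -- inequality.
  by_cases hxy : x = y
  · subst hxy
    have h0 : cross (m₁ - m₂) x = 0 := by
      refine cross_eq_zero_of_norm_add_norm_le (R := r₁ + r₂) hx ?_
      have e₁ : m₁ - m₂ + (r₁ + r₂) • x = (m₁ + r₁ • x) - (m₂ - r₂ • x) := by module
      have e₂ : -(m₁ - m₂ - (r₁ + r₂) • x) = (m₂ + r₂ • x) - (m₁ - r₁ • x) := by module
      rwa [← norm_neg (m₁ - m₂ - _), e₁, e₂]
    have h0' : cross (m₁ - m₂) x = cross m₁ x + cross x m₂ := by simp [cross]; ring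
    have e1 : cross m₁ x = 0 := by linarith
    have e2 : cross x m₂ = 0 := by linarith
    have := cross_smul_eq m₁ m₂ x
    rw [e1, hs m₂ x, e2] at this
    simp only [neg_zero, zero_smul, sub_zero] at this
    rcases smul_eq_zero.1 this with h | h
    · exact hm.ne' h
    · rw [h] at hx; simp at hx
  · have hlt : ⟪x, y⟫ < 1 := by
      rcases (inner_le_one hx hy).lt_or_eq with h | h
      · exact h
      · exact absurd ((inner_eq_one_iff_of_norm_eq_one hx hy).1 h) hxy
    have hcomm := real_inner_comm x y
    have hI1 := inner_sub_le_of_swap hx hy h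
    -- The same projections with `x` and `y` interchanged, for the angular order m₁, y, x, m₂.
    have hI2 : ⟪m₁, y - x⟫ + ⟪m₂, x - y⟫ ≤ (r₁ + r₂) * (1 - ⟪x, y⟫) := by
      have h1 := inner_le_norm_of_norm_eq_one hy ((m₁ + r₁ • x) - (m₂ - r₂ • y))
      have h2 := inner_le_norm_of_norm_eq_one hx ((m₂ + r₂ • y) - (m₁ - r₁ • x))
      simp only [inner_sub_left, inner_add_left, inner_sub_right, real_inner_smul_left,
        real_inner_self_eq_norm_sq, hx, hy, hcomm] at h1 h2 ⊢
      nlinarith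
    rw [hs] at hy₂ hx₂
    have hm' : 0 < -1 * cross m₂ m₁ := by rw [hs]; linarith
    have e₁ := hs m₁ x
    have e₂ := hs m₁ y
    have e₃ := hs x y
    have e₄ := hs m₂ x
    have e₅ := hs m₂ y
    rcases le_total 0 (cross x y) with hc | hc
    · have i₁ := le_inner_sub_of_cone (m := m₁) (m' := m₂) (s := 1) hx hy (by linarith)
        (by linarith) (by linarith) (by linarith) (by linarith)
      have i₂ := le_inner_sub_of_cone (m := m₂) (m' := m₁) (s := -1) hy hx hm'
        (by linarith) (by linarith) (by linarith) (by linarith)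
      rw [hcomm] at i₂
      nlinarith
    · have i₁ := le_inner_sub_of_cone (m := m₁) (m' := m₂) (s := 1) hy hx (by linarith)
        (by linarith) (by linarith) (by linarith) (by linarith)
      have i₂ := le_inner_sub_of_cone (m := m₂) (m' := m₁) (s := -1) hx hy hm'
        (by linarith) (by linarith) (by linarith) (by linarith)
      rw [hcomm] at i₁
      nlinarith

/-- If no exchange improves two segments, then one of their directions separates the rays through
their midpoints. -/
lemma pos_cross_mul_cross_or {m₁ m₂ x₁ x₂ : Plane} {r₁ r₂ : ℝ} (hx₁ : ‖x₁‖ = 1) (hx₂ : ‖x₂‖ = 1)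
    (h₁ : r₁ < ‖m₁‖) (h₂ : r₂ < ‖m₂‖) (hm : cross m₁ m₂ ≠ 0)
    (h : ∀ y₁ y₂, (y₁ = x₁ ∨ y₁ = -x₁) → (y₂ = x₂ ∨ y₂ = -x₂) →
      ‖(m₁ + r₁ • y₁) - (m₂ - r₂ • y₂)‖ + ‖(m₂ + r₂ • y₂) - (m₁ - r₁ • y₁)‖ ≤ 2 * (r₁ + r₂)) :
    0 < cross m₁ x₁ * cross m₂ x₁ ∨ 0 < cross m₁ x₂ * cross m₂ x₂ := by
  by_contra! hc
  -- The line ℝx meets the segment n₁n₂, so x or -x can be taken in their cone; a change of sign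
  -- only renames the endpoints of a segment.
  have flip : ∀ {n₁ n₂ x : Plane}, cross n₁ x * cross n₂ x ≤ 0 →
      ∃ y, (y = x ∨ y = -x) ∧ 0 ≤ cross n₁ y ∧ 0 ≤ cross y n₂ := by
    intro n₁ n₂ x hn
    rcases mul_nonpos_iff.1 hn with ⟨h1, h2⟩ | ⟨h1, h2⟩
    · exact ⟨x, .inl rfl, h1, by rw [cross_swap]; linarith⟩
    · refine ⟨-x, .inr rfl, by rw [cross_neg_right]; linarith, ?_⟩
      rw [cross_swap, cross_neg_right, neg_neg]; exact h2
  have norm_eq : ∀ {x y : Plane}, ‖x‖ = 1 → (y = x ∨ y = -x) → ‖y‖ = 1 := by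
    rintro x y hx (rfl | rfl) <;> simpa using hx
  rcases hm.lt_or_gt with hm | hm
  · obtain ⟨y₁, s₁, p₁, q₁⟩ := flip (n₁ := m₂) (n₂ := m₁) (mul_comm (cross m₁ x₁) _ ▸ hc.1)
    obtain ⟨y₂, s₂, p₂, q₂⟩ := flip (n₁ := m₂) (n₂ := m₁) (mul_comm (cross m₁ x₂) _ ▸ hc.2)
    refine false_of_cone (norm_eq hx₂ s₂) (norm_eq hx₁ s₁) h₂ h₁ ?_ p₂ q₂ p₁ q₁ ?_
    · rw [cross_swap]; linarith
    · rw [add_comm, add_comm r₂]; exact h _ _ s₁ s₂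
  · obtain ⟨y₁, s₁, p₁, q₁⟩ := flip hc.1
    obtain ⟨y₂, s₂, p₂, q₂⟩ := flip hc.2
    exact false_of_cone (norm_eq hx₁ s₁) (norm_eq hx₂ s₂) h₁ h₂ hm p₁ q₁ p₂ q₂ (h _ _ s₁ s₂)

/-! ### Exchanges among three segments -/

/-- Three segments whose directions wind around the origin can be improved by a cyclic exchange. -/
lemma false_of_winding {m₁ m₂ m₃ x₁ x₂ x₃ : Plane} {r₁ r₂ r₃ s : ℝ}
    (hx₁ : ‖x₁‖ = 1) (hx₂ : ‖x₂‖ = 1) (hx₃ : ‖x₃‖ = 1)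
    (h₁ : r₁ < ‖m₁‖) (h₂ : r₂ < ‖m₂‖) (h₃ : r₃ < ‖m₃‖)
    (h₁₂ : 0 < s * cross m₁ m₂) (h₂₃ : 0 < s * cross m₂ m₃) (h₃₁ : 0 < s * cross m₃ m₁)
    (a₁ : 0 < s * cross m₁ x₁ ∧ 0 < s * cross m₃ x₁ ∧ s * cross m₂ x₁ < 0)
    (a₂ : 0 < s * cross m₂ x₂ ∧ 0 < s * cross m₁ x₂ ∧ s * cross m₃ x₂ < 0)
    (a₃ : 0 < s * cross m₃ x₃ ∧ 0 < s * cross m₂ x₃ ∧ s * cross m₁ x₃ < 0)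
    (h : ‖(m₁ - r₁ • x₁) - (m₂ + r₂ • x₂)‖ + ‖(m₂ - r₂ • x₂) - (m₃ + r₃ • x₃)‖
      + ‖(m₃ - r₃ • x₃) - (m₁ + r₁ • x₁)‖ ≤ 2 * (r₁ + r₂ + r₃)) : False := by
  -- By the Plücker relation, consecutive directions turn the same way as the midpoints.
  have hpos : ∀ {m n x y : Plane}, 0 < s * cross m n → 0 < s * cross m x → 0 < s * cross n y →
      s * cross n x < 0 → 0 < s * cross m y → 0 < s * cross x y := by
    intro m n x y k1 k2 k3 k4 k5
    have e : (s * cross x y) * (s * cross m n) =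
        (s * cross m x) * (s * cross n y) - (s * cross n x) * (s * cross m y) := by
      linear_combination s ^ 2 * cross_mul_cross x y m n
    have h1 := mul_pos k2 k3
    have h2 := mul_neg_of_neg_of_pos k4 k5
    exact pos_of_mul_pos_left (by rw [e]; linarith) k1.le
  have c₁₂ := hpos h₁₂ a₁.1 a₂.1 a₁.2.2 a₂.2.1
  have c₂₃ := hpos h₂₃ a₂.1 a₃.1 a₂.2.2 a₃.2.1
  have c₃₁ := hpos h₃₁ a₃.1 a₁.1 a₃.2.2 a₁.2.1
  have i₁ := le_inner_sub hx₁ hx₂ a₁.1 a₂.2.1.le c₁₂.le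
  have i₂ := le_inner_sub hx₂ hx₃ a₂.1 a₃.2.1.le c₂₃.le
  have i₃ := le_inner_sub hx₃ hx₁ a₃.1 a₁.2.1.le c₃₁.le
  -- One strict inequality suffices; x₁ and x₂ differ because they lie on opposite sides of ℝm₃.
  have l₁₂ : ⟪x₁, x₂⟫ < 1 := by
    refine lt_of_le_of_ne (inner_le_one hx₁ hx₂) fun he => ?_
    rw [(inner_eq_one_iff_of_norm_eq_one hx₁ hx₂).1 he] at a₁
    linarith [a₁.2.1, a₂.2.2]
  have l₂₃ := inner_le_one hx₂ hx₃
  have l₃₁ := inner_le_one hx₃ hx₁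
  -- Each new edge is projected on the direction of the segment it enters; the sum is Σ⟪mᵢ, xᵢ -
  -- xᵢ₊₁⟫ + Σ rᵢ(1 + ⟪xᵢ, xᵢ₊₁⟫).
  have n₁ := inner_le_norm_of_norm_eq_one hx₂ (-((m₁ - r₁ • x₁) - (m₂ + r₂ • x₂)))
  have n₂ := inner_le_norm_of_norm_eq_one hx₃ (-((m₂ - r₂ • x₂) - (m₃ + r₃ • x₃)))
  have n₃ := inner_le_norm_of_norm_eq_one hx₁ (-((m₃ - r₃ • x₃) - (m₁ + r₁ • x₁)))
  rw [norm_neg] at n₁ n₂ n₃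
  simp only [inner_neg_left, inner_sub_left, inner_add_left, inner_sub_right, real_inner_smul_left,
    real_inner_self_eq_norm_sq, hx₁, hx₂, hx₃] at n₁ n₂ n₃ i₁ i₂ i₃
  have q₁ := mul_pos (sub_pos.2 h₁) (sub_pos.2 l₁₂)
  have q₂ := mul_nonneg (sub_pos.2 h₂).le (sub_nonneg.2 l₂₃)
  have q₃ := mul_nonneg (sub_pos.2 h₃).le (sub_nonneg.2 l₃₁)
  nlinarith

/-- Choose the sign that makes the first two products positive; the positive linear relation then
puts m₃ on the other side of ℝx. The factor `s` carries the orientation of the triangle. -/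
lemma exists_sign {m₁ m₂ m₃ x : Plane} {l₁ l₂ l₃ s : ℝ} (hl₃ : 0 < l₃) (hl₁ : 0 < l₁)
    (hl₂ : 0 < l₂) (hs : s ≠ 0) (hm : l₁ • m₁ + l₂ • m₂ + l₃ • m₃ = 0)
    (h : 0 < cross m₁ x * cross m₂ x) :
    ∃ y, (y = x ∨ y = -x) ∧ 0 < s * cross m₁ y ∧ 0 < s * cross m₂ y ∧ s * cross m₃ y < 0 := by
  have key : ∀ y, 0 < s * cross m₁ y → 0 < s * cross m₂ y → s * cross m₃ y < 0 := by
    intro y k1 k2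
    have e : l₁ * cross m₁ y + l₂ * cross m₂ y + l₃ * cross m₃ y = 0 := by
      have h0 := congrArg (fun v : Plane => v 0) hm
      have h1 := congrArg (fun v : Plane => v 1) hm
      simp at h0 h1
      simp only [cross]
      linear_combination y 1 * h0 - y 0 * h1
    have e' : l₁ * (s * cross m₁ y) + l₂ * (s * cross m₂ y) + l₃ * (s * cross m₃ y) = 0 := by
      linear_combination s * e
    nlinarith [mul_pos hl₁ k1, mul_pos hl₂ k2]
  have hsx : 0 < (s * cross m₁ x) * (s * cross m₂ x) := by
    have := mul_pos (pow_pos (abs_pos.2 hs) 2) h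
    rw [sq_abs] at this
    linarith
  rcases pos_and_pos_or_neg_and_neg_of_mul_pos hsx with ⟨k1, k2⟩ | ⟨k1, k2⟩
  · exact ⟨x, .inl rfl, k1, k2, key x k1 k2⟩
  · have k1' : 0 < s * cross m₁ (-x) := by rw [cross_neg_right]; linarith
    have k2' : 0 < s * cross m₂ (-x) := by rw [cross_neg_right]; linarith
    exact ⟨-x, .inr rfl, k1', k2', key _ k1' k2'⟩

/-- If m₁ and m₂ are on one side of ℝx, m₃ is on the other, so one line cannot serve two pairs. -/
lemma not_pos_of_pos {m₁ m₂ m₃ x : Plane} {l₁ l₂ l₃ : ℝ} (hl₁ : 0 < l₁) (hl₂ : 0 < l₂)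
    (hl₃ : 0 < l₃) (hm : l₁ • m₁ + l₂ • m₂ + l₃ • m₃ = 0)
    (h : 0 < cross m₁ x * cross m₂ x) : ¬ 0 < cross m₂ x * cross m₃ x := by
  obtain ⟨y, hy, h1, h2, h3⟩ := exists_sign hl₃ hl₁ hl₂ one_ne_zero hm h
  rw [one_mul] at h1 h2 h3
  have e : cross m₂ x * cross m₃ x = cross m₂ y * cross m₃ y := by
    rcases hy with rfl | rfl
    · rfl
    · rw [cross_neg_right, cross_neg_right, neg_mul_neg]
  rw [e]
  exact (mul_neg_of_pos_of_neg h2 h3).not_gt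

/-- Three segments which cannot be improved by exchanges, in general position. -/
lemma false_of_three {m₁ m₂ m₃ x₁ x₂ x₃ : Plane} {r₁ r₂ r₃ l₁ l₂ l₃ : ℝ}
    (hx₁ : ‖x₁‖ = 1) (hx₂ : ‖x₂‖ = 1) (hx₃ : ‖x₃‖ = 1)
    (h₁ : r₁ < ‖m₁‖) (h₂ : r₂ < ‖m₂‖) (h₃ : r₃ < ‖m₃‖)
    (hl₁ : 0 < l₁) (hl₂ : 0 < l₂) (hl₃ : 0 < l₃) (hm : l₁ • m₁ + l₂ • m₂ + l₃ • m₃ = 0)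
    (hc : cross m₁ m₂ ≠ 0)
    (k₁₂ : ∀ y₁ y₂, (y₁ = x₁ ∨ y₁ = -x₁) → (y₂ = x₂ ∨ y₂ = -x₂) →
      ‖(m₁ + r₁ • y₁) - (m₂ - r₂ • y₂)‖ + ‖(m₂ + r₂ • y₂) - (m₁ - r₁ • y₁)‖ ≤ 2 * (r₁ + r₂))
    (k₂₃ : ∀ y₁ y₂, (y₁ = x₂ ∨ y₁ = -x₂) → (y₂ = x₃ ∨ y₂ = -x₃) →
      ‖(m₂ + r₂ • y₁) - (m₃ - r₃ • y₂)‖ + ‖(m₃ + r₃ • y₂) - (m₂ - r₂ • y₁)‖ ≤ 2 * (r₂ + r₃))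
    (k₁₃ : ∀ y₁ y₂, (y₁ = x₁ ∨ y₁ = -x₁) → (y₂ = x₃ ∨ y₂ = -x₃) →
      ‖(m₁ + r₁ • y₁) - (m₃ - r₃ • y₂)‖ + ‖(m₃ + r₃ • y₂) - (m₁ - r₁ • y₁)‖ ≤ 2 * (r₁ + r₃))
    (k : ∀ y₁ y₂ y₃, (y₁ = x₁ ∨ y₁ = -x₁) → (y₂ = x₂ ∨ y₂ = -x₂) → (y₃ = x₃ ∨ y₃ = -x₃) →
      ‖(m₁ - r₁ • y₁) - (m₂ + r₂ • y₂)‖ + ‖(m₂ - r₂ • y₂) - (m₃ + r₃ • y₃)‖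
        + ‖(m₃ - r₃ • y₃) - (m₁ + r₁ • y₁)‖ ≤ 2 * (r₁ + r₂ + r₃)) : False := by
  have g0 := congrArg (fun v : Plane => v 0) hm
  have g1 := congrArg (fun v : Plane => v 1) hm
  simp at g0 g1
  -- Taking cross products with the linear relation shows that the triangle is traversed in one
  -- orientation.
  have e₂₃ : l₃ * cross m₂ m₃ = l₁ * cross m₁ m₂ := by
    simp only [cross]; linear_combination m₂ 0 * g1 - m₂ 1 * g0
  have e₃₁ : l₃ * cross m₃ m₁ = l₂ * cross m₁ m₂ := by
    simp only [cross]; linear_combination m₁ 1 * g0 - m₁ 0 * g1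
  have c₂₃ : cross m₂ m₃ ≠ 0 := fun h0 => by
    rw [h0, mul_zero, eq_comm, mul_eq_zero] at e₂₃
    exact e₂₃.elim hl₁.ne' hc
  have c₁₃ : cross m₁ m₃ ≠ 0 := fun h0 => by
    rw [cross_swap, h0, neg_zero, mul_zero, eq_comm, mul_eq_zero] at e₃₁
    exact e₃₁.elim hl₂.ne' hc
  have p₁₂ := pos_cross_mul_cross_or hx₁ hx₂ h₁ h₂ hc k₁₂
  have p₂₃ := pos_cross_mul_cross_or hx₂ hx₃ h₂ h₃ c₂₃ k₂₃
  have p₁₃ := pos_cross_mul_cross_or hx₁ hx₃ h₁ h₃ c₁₃ k₁₃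
  have norm_eq : ∀ {x y : Plane}, ‖x‖ = 1 → (y = x ∨ y = -x) → ‖y‖ = 1 := by
    rintro x y hx (rfl | rfl) <;> simpa using hx
  have neg_mem : ∀ {x y : Plane}, (y = x ∨ y = -x) → (-y = x ∨ -y = -x) := by
    rintro x y (rfl | rfl) <;> simp
  have s₁₂ : 0 < cross m₁ m₂ * cross m₁ m₂ := mul_self_pos.2 hc
  have s₂₃ : 0 < cross m₁ m₂ * cross m₂ m₃ := by
    refine pos_of_mul_pos_right (a := l₃) ?_ hl₃.le
    rw [mul_left_comm, e₂₃, mul_left_comm]; exact mul_pos hl₁ s₁₂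
  have s₃₁ : 0 < cross m₁ m₂ * cross m₃ m₁ := by
    refine pos_of_mul_pos_right (a := l₃) ?_ hl₃.le
    rw [mul_left_comm, e₃₁, mul_left_comm]; exact mul_pos hl₂ s₁₂
  have hm₁₃₂ : l₁ • m₁ + l₃ • m₃ + l₂ • m₂ = 0 := by rw [← hm]; abel
  have hm₂₁₃ : l₂ • m₂ + l₁ • m₁ + l₃ • m₃ = 0 := by rw [← hm]; abel
  have hm₂₃₁ : l₂ • m₂ + l₃ • m₃ + l₁ • m₁ = 0 := by rw [← hm]; abel
  have hm₃₂₁ : l₃ • m₃ + l₂ • m₂ + l₁ • m₁ = 0 := by rw [← hm]; abel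
  have caseA : 0 < cross m₁ x₁ * cross m₃ x₁ → 0 < cross m₁ x₂ * cross m₂ x₂ →
      0 < cross m₂ x₃ * cross m₃ x₃ → False := by
    intro t₁ t₂ t₃
    obtain ⟨y₁, u₁, v₁, w₁, z₁⟩ := exists_sign hl₂ hl₁ hl₃ hc hm₁₃₂ t₁
    obtain ⟨y₂, u₂, v₂, w₂, z₂⟩ := exists_sign hl₃ hl₁ hl₂ hc hm t₂
    obtain ⟨y₃, u₃, v₃, w₃, z₃⟩ := exists_sign hl₁ hl₂ hl₃ hc hm₂₃₁ t₃
    exact false_of_winding (norm_eq hx₁ u₁) (norm_eq hx₂ u₂) (norm_eq hx₃ u₃) h₁ h₂ h₃ s₁₂ s₂₃ s₃₁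
      ⟨v₁, w₁, z₁⟩ ⟨w₂, v₂, z₂⟩ ⟨w₃, v₃, z₃⟩ (k _ _ _ u₁ u₂ u₃)
  have caseB : 0 < cross m₁ x₁ * cross m₂ x₁ → 0 < cross m₂ x₂ * cross m₃ x₂ →
      0 < cross m₁ x₃ * cross m₃ x₃ → False := by
    intro t₁ t₂ t₃
    obtain ⟨y₁, u₁, v₁, w₁, z₁⟩ := exists_sign hl₃ hl₁ hl₂ (neg_ne_zero.2 hc) hm t₁
    obtain ⟨y₂, u₂, v₂, w₂, z₂⟩ := exists_sign hl₁ hl₂ hl₃ (neg_ne_zero.2 hc) hm₂₃₁ t₂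
    obtain ⟨y₃, u₃, v₃, w₃, z₃⟩ := exists_sign hl₂ hl₁ hl₃ (neg_ne_zero.2 hc) hm₁₃₂ t₃
    -- The mirror image of the other case: indices 2 and 3 trade places and the orientation
    -- reverses.
    refine false_of_winding (s := -cross m₁ m₂) (norm_eq hx₁ u₁) (norm_eq hx₃ u₃) (norm_eq hx₂ u₂)
      h₁ h₃ h₂ ?_ ?_ ?_ ⟨v₁, w₁, z₁⟩ ⟨w₃, v₃, z₃⟩ ⟨v₂, w₂, z₂⟩ ?_
    · rw [cross_swap m₁ m₃, neg_mul_neg]; exact s₃₁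
    · rw [cross_swap m₃ m₂, neg_mul_neg]; exact s₂₃
    · rw [cross_swap m₂ m₁, neg_mul_neg]; exact s₁₂
    · have := k _ _ _ (neg_mem u₁) (neg_mem u₂) (neg_mem u₃)
      simp only [smul_neg, sub_neg_eq_add, ← sub_eq_add_neg] at this
      rw [norm_sub_rev (m₁ - _), norm_sub_rev (m₃ - _), norm_sub_rev (m₂ - _)]
      linarith
  have n₁ : 0 < cross m₁ x₁ * cross m₂ x₁ → ¬ 0 < cross m₁ x₁ * cross m₃ x₁ := fun h =>
    not_pos_of_pos hl₂ hl₁ hl₃ hm₂₁₃ (mul_comm (cross m₁ x₁) _ ▸ h)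
  have n₂ : 0 < cross m₁ x₂ * cross m₂ x₂ → ¬ 0 < cross m₂ x₂ * cross m₃ x₂ :=
    not_pos_of_pos hl₁ hl₂ hl₃ hm
  have n₃ : 0 < cross m₁ x₃ * cross m₃ x₃ → ¬ 0 < cross m₂ x₃ * cross m₃ x₃ := fun h h' =>
    not_pos_of_pos hl₁ hl₃ hl₂ hm₁₃₂ h (mul_comm (cross m₂ x₃) _ ▸ h')
  -- Each pair is served by one of its own two lines and each line serves at most one of its pairs,
  -- leaving only the two cyclic assignments.
  tauto

/-! ### Midpoints on opposite rays -/

/-- Two segments whose midpoints lie on opposite rays can be improved. -/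
lemma false_of_opposite {m₁ m₂ x₁ x₂ : Plane} {r₁ r₂ : ℝ} (h₁ : r₁ < ‖m₁‖) (h₂ : r₂ < ‖m₂‖)
    (hc : cross m₁ m₂ = 0) (hi : ⟪m₁, m₂⟫ ≤ 0)
    (h : ‖(m₁ + r₁ • x₁) - (m₂ - r₂ • x₂)‖ + ‖(m₂ + r₂ • x₂) - (m₁ - r₁ • x₁)‖ ≤ 2 * (r₁ + r₂)) :
    False := by
  have e : ⟪m₁, m₂⟫ = -(‖m₁‖ * ‖m₂‖) := by
    have := inner_sq_add_cross_sq m₁ m₂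
    rw [hc, ← mul_pow] at this
    have h3 : (-⟪m₁, m₂⟫) ^ 2 = (‖m₁‖ * ‖m₂‖) ^ 2 := by linarith
    have := (pow_left_inj₀ (by linarith) (by positivity) two_ne_zero).1 h3
    linarith
  have hn : ‖m₁ - m₂‖ = ‖m₁‖ + ‖m₂‖ := by
    refine (pow_left_inj₀ (norm_nonneg _) (by positivity) two_ne_zero).1 ?_
    rw [norm_sub_sq_real, e]; ring
  -- The two new edge vectors differ by 2(m₁ - m₂) whatever the directions are, so their total
  -- length is at least 2(‖m₁‖ + ‖m₂‖).
  have h2 := norm_sub_le ((m₁ + r₁ • x₁) - (m₂ - r₂ • x₂)) ((m₂ + r₂ • x₂) - (m₁ - r₁ • x₁))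
  have h3 : ((m₁ + r₁ • x₁) - (m₂ - r₂ • x₂)) - ((m₂ + r₂ • x₂) - (m₁ - r₁ • x₁)) =
      (2 : ℝ) • (m₁ - m₂) := by module
  rw [h3, norm_smul, hn] at h2
  norm_num at h2
  linarith

/-! ### The point of least maximal power -/

/-- A point minimizing the largest power with respect to finitely many balls lies in the convex hull
of the centers of those balls for which the power is the largest. -/
lemma exists_mem_convexHull_centers {E ι : Type*} [NormedAddCommGroup E] [InnerProductSpace ℝ E]
    [Fintype ι] [Nonempty ι] (m : ι → E) (r : ι → ℝ) :
    ∃ (o : E) (c : ℝ), (∀ i, ‖m i - o‖ ^ 2 - r i ^ 2 ≤ c) ∧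
      o ∈ convexHull ℝ (m '' {i | ‖m i - o‖ ^ 2 - r i ^ 2 = c}) := by
  classical
  let k : ι → ℝ := fun i => ‖m i‖ ^ 2 - r i ^ 2
  -- This is the dual concave quadratic program on the simplex; its optimal weights give o, and its
  -- optimal value is the maximal power c.
  obtain ⟨l, hl, hmax⟩ := (isCompact_stdSimplex ℝ ι).exists_isMaxOn
    ⟨_, single_mem_stdSimplex ℝ (Classical.arbitrary ι)⟩
    (f := fun l : ι → ℝ => ∑ i, l i * k i - ‖∑ i, l i • m i‖ ^ 2) (by fun_prop)
  set o := ∑ i, l i • m i with ho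
  set K := ∑ i, l i * k i with hK
  have hpow : ∀ i, ‖m i - o‖ ^ 2 - r i ^ 2 = k i - 2 * ⟪m i, o⟫ + ‖o‖ ^ 2 := by
    intro i
    rw [norm_sub_sq_real]; simp only [k]; ring
  have hle : ∀ i, ‖m i - o‖ ^ 2 - r i ^ 2 ≤ K - ‖o‖ ^ 2 := by
    intro i
    by_contra! hlt
    rw [hpow] at hlt
    set A := k i - K - 2 * ⟪m i, o⟫ + 2 * ‖o‖ ^ 2 with hA
    have hApos : 0 < A := by linarith
    -- Moving from l towards the i-th vertex by t changes the objective by tA - t²‖m i - o‖².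
    have key : ∀ t : ℝ, 0 ≤ t → t ≤ 1 → t * A ≤ t ^ 2 * ‖m i - o‖ ^ 2 := by
      intro t ht0 ht1
      have hmem : (1 - t) • l + t • Pi.single i (1 : ℝ) ∈ stdSimplex ℝ ι :=
        convex_stdSimplex ℝ ι hl (single_mem_stdSimplex ℝ i) (by linarith) ht0 (by ring)
      have := hmax hmem
      simp only [Set.mem_ofPred_eq] at this
      have e1 : ∑ j, ((1 - t) • l + t • Pi.single i (1 : ℝ) : ι → ℝ) j * k j = (1 - t) * K + t * k i := by
        simp [add_mul, Finset.sum_add_distrib, Pi.single_apply, mul_assoc, ← Finset.mul_sum, hK]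
      have e2 : ∑ j, ((1 - t) • l + t • Pi.single i (1 : ℝ) : ι → ℝ) j • m j = o + t • (m i - o) := by
        simp [add_smul, Finset.sum_add_distrib, Pi.single_apply, mul_smul, ← Finset.smul_sum, ← ho]
        module
      rw [e1, e2, norm_add_sq_real, real_inner_smul_right, norm_smul, mul_pow, Real.norm_eq_abs,
        sq_abs, inner_sub_right, real_inner_self_eq_norm_sq, real_inner_comm] at this
      rw [hA]
      linarith
    set B := ‖m i - o‖ ^ 2 with hB
    have hBnn : 0 ≤ B := by positivity
    have hden : 0 < A + B := by linarith
    -- For t = A / (2(A + B)) one has t ≤ 1 and tB ≤ A / 2 < A, which contradicts optimality.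
    have h1 := key (A / (A + B) / 2) (by positivity) (by
      rw [div_div, div_le_one (by positivity)]; linarith)
    have h2 : A * (A / (A + B) / 2) ≤ (A / (A + B) / 2) * (A / (A + B) / 2) * B := by linarith
    have hT : 0 < A / (A + B) / 2 := by positivity
    have h3 : A ≤ (A / (A + B) / 2) * B := by nlinarith
    have h4 : A / (A + B) * B ≤ A := by
      rw [div_mul_eq_mul_div, div_le_iff₀ hden]; nlinarith
    linarith
  refine ⟨o, K - ‖o‖ ^ 2, hle, ?_⟩
  -- Complementary slackness: the weighted slacks sum to zero, so positive weight forces maximal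
  -- power.
  have hsum : ∑ i, l i * (K - ‖o‖ ^ 2 - (‖m i - o‖ ^ 2 - r i ^ 2)) = 0 := by
    have h1 : ∑ i, l i * ⟪m i, o⟫ = ‖o‖ ^ 2 := by
      rw [← real_inner_self_eq_norm_sq, ho, sum_inner]
      simp [real_inner_smul_left]
    have h2 : ∀ i, l i * (K - ‖o‖ ^ 2 - (‖m i - o‖ ^ 2 - r i ^ 2)) =
        l i * (K - 2 * ‖o‖ ^ 2) - l i * k i + 2 * (l i * ⟪m i, o⟫) := by
      intro i; rw [hpow]; ring
    simp only [h2]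
    rw [Finset.sum_add_distrib, Finset.sum_sub_distrib, ← Finset.sum_mul, ← Finset.mul_sum, h1,
      hl.2, ← hK]
    ring
  have hzero : ∀ i, l i * (K - ‖o‖ ^ 2 - (‖m i - o‖ ^ 2 - r i ^ 2)) = 0 := by
    intro i
    exact (Finset.sum_eq_zero_iff_of_nonneg
      (fun i _ => mul_nonneg (hl.1 i) (sub_nonneg.2 (hle i)))).1 hsum i (Finset.mem_univ i)
  have hact : ∀ i, l i ≠ 0 → ‖m i - o‖ ^ 2 - r i ^ 2 = K - ‖o‖ ^ 2 := by
    intro i hi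
    have := (mul_eq_zero.1 (hzero i)).resolve_left hi
    linarith
  have hs1 : ∑ i with l i ≠ 0, l i = 1 := by rw [Finset.sum_filter_ne_zero, hl.2]
  have hs2 : ∑ i with l i ≠ 0, l i • m i = o := by
    rw [ho]
    refine Finset.sum_subset (Finset.subset_univ _) fun i _ hi => ?_
    simp only [Finset.mem_filter, Finset.mem_univ, true_and, not_not] at hi
    rw [hi, zero_smul]
  have hmem := (convex_convexHull ℝ (m '' {i | ‖m i - o‖ ^ 2 - r i ^ 2 = K - ‖o‖ ^ 2})).sum_mem
    (t := Finset.univ.filter fun i => l i ≠ 0) (w := l) (z := m) (fun i _ => hl.1 i) hs1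
    (fun i hi => subset_convexHull ℝ _ ⟨i, hact i (by simpa using hi), rfl⟩)
  rwa [hs2] at hmem

/-! ### Carathéodory reduction to at most three discs -/

/-- If no exchange improves a finite family of segments of the plane, then their diametral discs
have a common point. -/
lemma exists_forall_norm_sub_le {ι : Type*} [Finite ι] (m x : ι → Plane) (r : ι → ℝ)
    (hx : ∀ i, ‖x i‖ = 1) (hr : ∀ i, 0 ≤ r i)
    (h₂ : ∀ i j, i ≠ j → ∀ y₁ y₂, (y₁ = x i ∨ y₁ = -x i) → (y₂ = x j ∨ y₂ = -x j) →
      ‖(m i + r i • y₁) - (m j - r j • y₂)‖ + ‖(m j + r j • y₂) - (m i - r i • y₁)‖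
        ≤ 2 * (r i + r j))
    (h₃ : ∀ i j k, i ≠ j → j ≠ k → k ≠ i → ∀ y₁ y₂ y₃, (y₁ = x i ∨ y₁ = -x i) →
      (y₂ = x j ∨ y₂ = -x j) → (y₃ = x k ∨ y₃ = -x k) →
      ‖(m i - r i • y₁) - (m j + r j • y₂)‖ + ‖(m j - r j • y₂) - (m k + r k • y₃)‖
        + ‖(m k - r k • y₃) - (m i + r i • y₁)‖ ≤ 2 * (r i + r j + r k)) :
    ∃ o, ∀ i, ‖m i - o‖ ≤ r i := by
  cases nonempty_fintype ι
  rcases isEmpty_or_nonempty ι with hι | hι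
  · exact ⟨0, fun i => hι.elim i⟩
  obtain ⟨o, c, hle, ho⟩ := exists_mem_convexHull_centers m r
  refine ⟨o, fun i => ?_⟩
  suffices hc : c ≤ 0 from le_of_sq_le_sq (by linarith [hle i]) (hr i)
  by_contra! hc
  obtain ⟨κ, _, z, w, hz, hind, hw, hw1, hwo⟩ := eq_pos_convex_span_of_mem_convexHull ho
  choose f hf hfz using fun k => hz (Set.mem_range_self k)
  have hfinj : Function.Injective f := fun a b hab => hind.injective (by
    rw [← hfz a, ← hfz b, hab])
  have hout : ∀ k, r (f k) < ‖m (f k) - o‖ := fun k =>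
    lt_of_pow_lt_pow_left₀ 2 (norm_nonneg _) (by have : _ = c := hf k; linarith)
  have hsum : ∑ k, w k • (m (f k) - o) = 0 := by
    simp only [smul_sub, Finset.sum_sub_distrib, hfz, hwo]
    rw [← Finset.sum_smul, hw1, one_smul, sub_self]
  have t₂ : ∀ a b, a ≠ b → ∀ y₁ y₂, (y₁ = x (f a) ∨ y₁ = -x (f a)) →
      (y₂ = x (f b) ∨ y₂ = -x (f b)) →
      ‖(m (f a) - o + r (f a) • y₁) - (m (f b) - o - r (f b) • y₂)‖
        + ‖(m (f b) - o + r (f b) • y₂) - (m (f a) - o - r (f a) • y₁)‖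
        ≤ 2 * (r (f a) + r (f b)) := by
    intro a b hab y₁ y₂ s₁ s₂
    have trans : ∀ u v w z : Plane, u - o + v - (w - o - z) = u + v - (w - z) := fun u v w z => by
      abel
    rw [trans, trans]
    exact h₂ _ _ (hfinj.ne hab) y₁ y₂ s₁ s₂
  have opp : ∀ a b, a ≠ b → cross (m (f a) - o) (m (f b) - o) = 0 →
      0 < ⟪m (f a) - o, m (f b) - o⟫ := by
    intro a b hab h0
    by_contra! hi
    exact false_of_opposite (hout a) (hout b) h0 hi (t₂ a b hab _ _ (.inl rfl) (.inl rfl))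
  have npos : ∀ k, 0 < ‖m (f k) - o‖ := fun k => (hr _).trans_lt (hout k)
  have hcard : Fintype.card κ ≤ 3 := by
    have := hind.card_le_finrank_succ
    have h2 := Submodule.finrank_le (vectorSpan ℝ (Set.range z))
    rw [finrank_euclideanSpace_fin] at h2
    omega
  have comp : ∀ {n : ℕ} (e : Fin n ≃ κ), ∑ k, w (e k) • (m (f (e k)) - o) = 0 := fun e => by
    rw [← hsum, ← Equiv.sum_comp e]
  obtain ⟨n, hn⟩ : ∃ n, n = Fintype.card κ := ⟨_, rfl⟩
  have e : Fin n ≃ κ := (Fintype.equivFinOfCardEq hn.symm).symm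
  have hs := comp e
  rw [← hn] at hcard
  interval_cases n
  · have := Equiv.sum_comp e w
    simp [hw1] at this
  · simp only [Fin.sum_univ_one, smul_eq_zero] at hs
    rcases hs with h | h
    · exact (hw _).ne' h
    · have := npos (e 0)
      rw [h, norm_zero] at this
      exact this.false
  · rw [Fin.sum_univ_two] at hs
    have hne : e 0 ≠ e 1 := e.injective.ne (by decide)
    have hi := congrArg (fun v => ⟪m (f (e 0)) - o, v⟫) hs
    have g0 := congrArg (fun v : Plane => v 0) hs
    have g1 := congrArg (fun v : Plane => v 1) hs
    simp only [inner_add_right, real_inner_smul_right, inner_zero_right,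
      real_inner_self_eq_norm_sq] at hi
    simp only [PiLp.add_apply, PiLp.smul_apply, smul_eq_mul, PiLp.zero_apply] at g0 g1
    have hcr : cross (m (f (e 0)) - o) (m (f (e 1)) - o) = 0 := by
      refine (mul_eq_zero.1 ?_).resolve_left (hw (e 1)).ne'
      simp only [cross]
      linear_combination (m (f (e 0)) - o) 0 * g1 - (m (f (e 0)) - o) 1 * g0
    -- Pairing the relation with the first vector gives a sum of positive terms equal to zero.
    have p1 := mul_pos (hw (e 1)) (opp _ _ hne hcr)
    have p2 := mul_pos (hw (e 0)) (pow_pos (npos (e 0)) 2)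
    linarith
  · rw [Fin.sum_univ_three] at hs
    have hne01 : e 0 ≠ e 1 := e.injective.ne (by decide)
    have hne12 : e 1 ≠ e 2 := e.injective.ne (by decide)
    have hne02 : e 0 ≠ e 2 := e.injective.ne (by decide)
    -- If the cross product vanishes, all three vectors are parallel, and `opp` makes the first have
    -- positive inner product with the others.
    by_cases hcr : cross (m (f (e 0)) - o) (m (f (e 1)) - o) = 0
    · have hi := congrArg (fun v => ⟪m (f (e 0)) - o, v⟫) hs
      have g0 := congrArg (fun v : Plane => v 0) hs
      have g1 := congrArg (fun v : Plane => v 1) hs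
      simp only [inner_add_right, real_inner_smul_right, inner_zero_right,
        real_inner_self_eq_norm_sq] at hi
      simp only [PiLp.add_apply, PiLp.smul_apply, smul_eq_mul, PiLp.zero_apply] at g0 g1
      have hcr2 : cross (m (f (e 0)) - o) (m (f (e 2)) - o) = 0 := by
        refine (mul_eq_zero.1 ?_).resolve_left (hw (e 2)).ne'
        simp only [cross] at hcr ⊢
        linear_combination (m (f (e 0)) - o) 0 * g1 - (m (f (e 0)) - o) 1 * g0 - w (e 1) * hcr
      have p1 := mul_pos (hw (e 1)) (opp _ _ hne01 hcr)
      have p2 := mul_pos (hw (e 2)) (opp _ _ hne02 hcr2)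
      have p3 := mul_pos (hw (e 0)) (pow_pos (npos (e 0)) 2)
      linarith
    · refine false_of_three (hx _) (hx _) (hx _) (hout (e 0)) (hout (e 1)) (hout (e 2)) (hw _)
        (hw _) (hw _) hs hcr (t₂ _ _ hne01) (t₂ _ _ hne12) (t₂ _ _ hne02) ?_
      intro y₁ y₂ y₃ s₁ s₂ s₃
      have trans : ∀ u v w z : Plane, u - o - v - (w - o + z) = u - v - (w + z) := fun u v w z => by
        abel
      rw [trans, trans, trans]
      exact h₃ _ _ _ (hfinj.ne hne01) (hfinj.ne hne12) (hfinj.ne hne02.symm) y₁ y₂ y₃ s₁ s₂ s₃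

/-! ### Competing matchings from vertex permutations -/

variable {V : Type*}

lemma edgeLength_mk {d : ℕ} (p : V → EuclideanSpace ℝ (Fin d)) (v w : V) :
    edgeLength p s(v, w) = dist (p v) (p w) := rfl

lemma edgeLength_map {d : ℕ} (p : V → EuclideanSpace ℝ (Fin d)) (τ : Equiv.Perm V) (e : Sym2 V) :
    edgeLength p (e.map τ) = edgeLength (p ∘ τ) e := by
  induction e with
  | _ v w => rfl

lemma IsPerfectMatching.existsUnique {M : SimpleGraph V} (hM : IsPerfectMatching M) (v : V) :
    ∃! w, M.Adj v w := by
  simpa using SimpleGraph.Subgraph.isPerfectMatching_iff.1 hM v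

lemma map_perm_adj {M : SimpleGraph V} {τ : Equiv.Perm V} {v w : V} :
    (M.map τ).Adj v w ↔ M.Adj (τ.symm v) (τ.symm w) := by
  constructor
  · rintro ⟨-, a, b, hab, rfl, rfl⟩
    simpa using hab
  · intro h
    exact ⟨fun hvw => h.ne (by rw [hvw]), _, _, h, by simp, by simp⟩

lemma IsPerfectMatching.map {M : SimpleGraph V} (hM : IsPerfectMatching M) (τ : Equiv.Perm V) :
    IsPerfectMatching (M.map τ) := by
  refine SimpleGraph.Subgraph.isPerfectMatching_iff.2 fun v => ?_
  simp only [SimpleGraph.Subgraph.top_adj, map_perm_adj]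
  obtain ⟨w, hw, huniq⟩ := hM.existsUnique (τ.symm v)
  refine ⟨τ w, by simpa using hw, fun u hu => ?_⟩
  rw [← huniq _ hu, Equiv.apply_symm_apply]

/-- Relabelling edges by τ turns a competing matching into the same graph with permuted points, so
costs compare edge by edge. -/
lemma cost_map [Fintype V] {d : ℕ} (p : V → EuclideanSpace ℝ (Fin d)) (M : SimpleGraph V)
    (τ : Equiv.Perm V) : cost p (M.map τ) = cost (p ∘ τ) M := by
  classical
  unfold cost
  refine (Finset.sum_bij (fun e _ => e.map τ) ?_ ?_ ?_ ?_).symm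
  · intro e he
    induction e with
    | _ v w => simpa [map_perm_adj] using he
  · intro e _ e' _ h
    exact Sym2.map.injective τ.injective h
  · intro e he
    induction e with
    | _ v w =>
      exact ⟨s(τ.symm v, τ.symm w), by simpa [map_perm_adj] using he, by simp⟩
  · intro e _
    rw [edgeLength_map]

/-- Permuting the vertices of some edges of a max-sum matching does not increase their total
length. -/
lemma IsMaxSumMatching.sum_le [Fintype V] {d : ℕ} {p : V → EuclideanSpace ℝ (Fin d)}
    {M : SimpleGraph V} (hM : IsMaxSumMatching p M) (τ : Equiv.Perm V) (s : Finset (Sym2 V))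
    (hs : ∀ e ∈ s, e ∈ M.edgeSet)
    (hτ : ∀ v w, M.Adj v w → s(v, w) ∉ s → τ v = v ∧ τ w = w) :
    ∑ e ∈ s, edgeLength (p ∘ τ) e ≤ ∑ e ∈ s, edgeLength p e := by
  classical
  have h := hM.2 _ (hM.1.map τ)
  rw [cost_map] at h
  unfold cost at h
  have hsub : s ⊆ M.edgeFinset := fun e he => by simpa using hs e he
  rw [← Finset.sum_sdiff hsub, ← Finset.sum_sdiff hsub (f := edgeLength p)] at h
  have he : ∑ e ∈ M.edgeFinset \ s, edgeLength (p ∘ τ) e =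
      ∑ e ∈ M.edgeFinset \ s, edgeLength p e := by
    refine Finset.sum_congr rfl fun e he => ?_
    induction e with
    | _ v w =>
      simp only [Finset.mem_sdiff, SimpleGraph.mem_edgeFinset, SimpleGraph.mem_edgeSet] at he
      obtain ⟨h1, h2⟩ := hτ v w he.1 he.2
      simp [edgeLength_mk, h1, h2]
  linarith

lemma IsPerfectMatching.eq_of_adj {M : SimpleGraph V} (hM : IsPerfectMatching M) {a b c : V}
    (hb : M.Adj a b) (hc : M.Adj a c) : b = c :=
  (hM.existsUnique a).unique hb hc

/-- Apply the transposition of b and b'; distinct edges of a matching share no vertex. -/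
lemma IsMaxSumMatching.swap_le [Fintype V] {d : ℕ} {p : V → EuclideanSpace ℝ (Fin d)}
    {M : SimpleGraph V} (hM : IsMaxSumMatching p M) {a b a' b' : V} (h : M.Adj a b)
    (h' : M.Adj a' b') (hne : s(a, b) ≠ s(a', b')) :
    dist (p a) (p b') + dist (p a') (p b) ≤ dist (p a) (p b) + dist (p a') (p b') := by
  classical
  have uniq := fun {x y z : V} => hM.1.eq_of_adj (a := x) (b := y) (c := z)
  have hab := h.ne
  have hab' := h'.ne
  have h1 : a ≠ b' := by rintro rfl; rw [uniq h h'.symm] at hne; exact hne Sym2.eq_swap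
  have h2 : a' ≠ b := by rintro rfl; rw [uniq h' h.symm] at hne; exact hne Sym2.eq_swap
  have key := hM.sum_le (Equiv.swap b b') {s(a, b), s(a', b')} (by simp [h, h']) (by
    intro v w hvw hn
    simp only [Finset.mem_insert, Finset.mem_singleton, not_or] at hn
    constructor <;> refine Equiv.swap_apply_of_ne_of_ne ?_ ?_ <;> rintro rfl
    · exact hn.1 (by rw [uniq hvw h.symm, Sym2.eq_swap])
    · exact hn.2 (by rw [uniq hvw h'.symm, Sym2.eq_swap])
    · exact hn.1 (by rw [uniq hvw.symm h.symm])
    · exact hn.2 (by rw [uniq hvw.symm h'.symm]))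
  rw [Finset.sum_pair hne, Finset.sum_pair hne] at key
  simpa [edgeLength_mk, Equiv.swap_apply_of_ne_of_ne hab h1,
    Equiv.swap_apply_of_ne_of_ne h2 hab'] using key

/-- Apply the 3-cycle b → b' → b'' → b, which leaves all other vertices fixed. -/
lemma IsMaxSumMatching.rotate_le [Fintype V] {d : ℕ} {p : V → EuclideanSpace ℝ (Fin d)}
    {M : SimpleGraph V} (hM : IsMaxSumMatching p M) {a b a' b' a'' b'' : V} (h : M.Adj a b)
    (h' : M.Adj a' b') (h'' : M.Adj a'' b'') (hne : s(a, b) ≠ s(a', b'))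
    (hne' : s(a', b') ≠ s(a'', b'')) (hne'' : s(a'', b'') ≠ s(a, b)) :
    dist (p a) (p b') + dist (p a') (p b'') + dist (p a'') (p b)
      ≤ dist (p a) (p b) + dist (p a') (p b') + dist (p a'') (p b'') := by
  classical
  have uniq := fun {x y z : V} => hM.1.eq_of_adj (a := x) (b := y) (c := z)
  have disj : ∀ {x y x' y' : V}, M.Adj x y → M.Adj x' y' → s(x, y) ≠ s(x', y') →
      x ≠ y' ∧ y ≠ y' := by
    intro x y x' y' k k' kne
    refine ⟨?_, ?_⟩ <;> rintro rfl
    · rw [uniq k k'.symm] at kne; exact kne Sym2.eq_swap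
    · rw [uniq k.symm k'.symm] at kne; exact kne rfl
  obtain ⟨n1, n2⟩ := disj h h' hne
  obtain ⟨n3, n4⟩ := disj h' h'' hne'
  obtain ⟨n5, n6⟩ := disj h'' h hne''
  obtain ⟨n7, -⟩ := disj h h'' hne''.symm
  obtain ⟨n8, -⟩ := disj h' h hne.symm
  obtain ⟨n9, -⟩ := disj h'' h' hne'.symm
  have hfix : ∀ v, v ≠ b → v ≠ b' → v ≠ b'' →
      (Equiv.swap b b' * Equiv.swap b' b'') v = v := by
    intro v k1 k2 k3
    rw [Equiv.Perm.mul_apply, Equiv.swap_apply_of_ne_of_ne k2 k3,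
      Equiv.swap_apply_of_ne_of_ne k1 k2]
  have key := hM.sum_le (Equiv.swap b b' * Equiv.swap b' b'')
    {s(a, b), s(a', b'), s(a'', b'')} (by simp [h, h', h'']) (by
    intro v w hvw hn
    simp only [Finset.mem_insert, Finset.mem_singleton, not_or] at hn
    constructor <;> refine hfix _ ?_ ?_ ?_ <;> rintro rfl
    · exact hn.1 (by rw [uniq hvw h.symm, Sym2.eq_swap])
    · exact hn.2.1 (by rw [uniq hvw h'.symm, Sym2.eq_swap])
    · exact hn.2.2 (by rw [uniq hvw h''.symm, Sym2.eq_swap])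
    · exact hn.1 (by rw [uniq hvw.symm h.symm])
    · exact hn.2.1 (by rw [uniq hvw.symm h'.symm])
    · exact hn.2.2 (by rw [uniq hvw.symm h''.symm]))
  have e1 : (Equiv.swap b b' * Equiv.swap b' b'') b = b' := by
    rw [Equiv.Perm.mul_apply, Equiv.swap_apply_of_ne_of_ne n2 n6.symm, Equiv.swap_apply_left]
  have e2 : (Equiv.swap b b' * Equiv.swap b' b'') b' = b'' := by
    rw [Equiv.Perm.mul_apply, Equiv.swap_apply_left,
      Equiv.swap_apply_of_ne_of_ne n6 n4.symm]
  have e3 : (Equiv.swap b b' * Equiv.swap b' b'') b'' = b := by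
    rw [Equiv.Perm.mul_apply, Equiv.swap_apply_right, Equiv.swap_apply_right]
  have hsum : ∀ f : Sym2 V → ℝ, ∑ e ∈ {s(a, b), s(a', b'), s(a'', b'')}, f e =
      f s(a, b) + f s(a', b') + f s(a'', b'') := by
    intro f
    rw [Finset.sum_insert (by simp only [Finset.mem_insert, Finset.mem_singleton, not_or];
                              exact ⟨hne, hne''.symm⟩), Finset.sum_pair hne', add_assoc]
  rw [hsum, hsum] at key
  simpa only [edgeLength_mk, Function.comp_apply, e1, e2, e3, hfix a h.ne n1 n7,
    hfix a' n8 h'.ne n3, hfix a'' n5 n9 h''.ne] using key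

/-! ### From the matching to its segments -/

lemma exists_unit_smul_eq (v : Plane) : ∃ x : Plane, ‖x‖ = 1 ∧ ‖v‖ • x = v := by
  by_cases hv : v = 0
  -- An edge of length zero gets an arbitrary unit direction.
  · exact ⟨EuclideanSpace.single 0 1, by simp, by simp [hv]⟩
  · have : ‖v‖ ≠ 0 := norm_ne_zero_iff.2 hv
    exact ⟨‖v‖⁻¹ • v, by rw [norm_smul, norm_inv, norm_norm, inv_mul_cancel₀ this],
      by rw [smul_smul, mul_inv_cancel₀ this, one_smul]⟩

end MaxSumMatching

theorem theorem4 {V : Type*} [Fintype V] (hV : Even (Fintype.card V))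
    (p : V → EuclideanSpace ℝ (Fin 2)) (M : SimpleGraph V)
    (hM : MaxSumMatching.IsMaxSumMatching p M) :
    MaxSumMatching.IsTverbergGraph p M := by
  have hends : ∀ e : M.edgeSet, ∃ a b, M.Adj a b ∧ (e : Sym2 V) = s(a, b) := by
    rintro ⟨e, he⟩
    induction e with
    | _ a b => exact ⟨a, b, he, rfl⟩
  choose a b hab he using hends
  choose x hx hxe using fun e : M.edgeSet =>
    MaxSumMatching.exists_unit_smul_eq ((1 / 2 : ℝ) • (p (a e) - p (b e)))
  set r : M.edgeSet → ℝ := fun e => dist (p (a e)) (p (b e)) / 2 with hr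
  set m : M.edgeSet → MaxSumMatching.Plane := fun e => midpoint ℝ (p (a e)) (p (b e)) with hm
  have hre : ∀ e, r e • x e = (1 / 2 : ℝ) • (p (a e) - p (b e)) := by
    intro e
    conv_rhs => rw [← hxe e]
    congr 1
    simp only [hr]
    rw [norm_smul, dist_eq_norm]; norm_num
    ring
  -- The sign of y decides which endpoint comes first, so the sign choices cover all re-pairings.
  have hends : ∀ e y, (y = x e ∨ y = -x e) → ∃ v w, M.Adj v w ∧ (e : Sym2 V) = s(v, w) ∧
      m e + r e • y = p v ∧ m e - r e • y = p w ∧ 2 * r e = dist (p v) (p w) := by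
    rintro e y (rfl | rfl)
    · refine ⟨a e, b e, hab e, he e, ?_, ?_, by simp only [hr]; ring⟩ <;>
      · rw [hre]; simp only [hm, midpoint_eq_smul_add, invOf_eq_inv]; module
    · refine ⟨b e, a e, (hab e).symm, by rw [he e, Sym2.eq_swap], ?_, ?_,
        by simp only [hr, dist_comm (p (b e))]; ring⟩ <;>
      · rw [smul_neg, hre]; simp only [hm, midpoint_eq_smul_add, invOf_eq_inv]; module
  obtain ⟨o, ho⟩ := MaxSumMatching.exists_forall_norm_sub_le m x r hx
    (fun e => by simp only [hr]; positivity)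
    (by
      intro e₁ e₂ hne y₁ y₂ h₁ h₂
      obtain ⟨v₁, w₁, k₁, q₁, g₁, g₁', d₁⟩ := hends e₁ y₁ h₁
      obtain ⟨v₂, w₂, k₂, q₂, g₂, g₂', d₂⟩ := hends e₂ y₂ h₂
      have := hM.swap_le k₁ k₂ (by rw [← q₁, ← q₂]; exact Subtype.coe_injective.ne hne)
      rw [g₁, g₁', g₂, g₂', ← dist_eq_norm, ← dist_eq_norm, mul_add, d₁, d₂]
      exact this)
    (by
      intro e₁ e₂ e₃ hne₁₂ hne₂₃ hne₃₁ y₁ y₂ y₃ h₁ h₂ h₃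
      obtain ⟨v₁, w₁, k₁, q₁, g₁, g₁', d₁⟩ := hends e₁ y₁ h₁
      obtain ⟨v₂, w₂, k₂, q₂, g₂, g₂', d₂⟩ := hends e₂ y₂ h₂
      obtain ⟨v₃, w₃, k₃, q₃, g₃, g₃', d₃⟩ := hends e₃ y₃ h₃
      -- The edges are reversed because the cyclic exchange joins the end m - r y of each segment to
      -- the end m + r y of the next.
      have := hM.rotate_le k₁.symm k₂.symm k₃.symm
        (by rw [Sym2.eq_swap, ← q₁, Sym2.eq_swap, ← q₂]; exact Subtype.coe_injective.ne hne₁₂)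
        (by rw [Sym2.eq_swap, ← q₂, Sym2.eq_swap, ← q₃]; exact Subtype.coe_injective.ne hne₂₃)
        (by rw [Sym2.eq_swap, ← q₃, Sym2.eq_swap, ← q₁]; exact Subtype.coe_injective.ne hne₃₁)
      rw [g₁, g₁', g₂, g₂', g₃, g₃', ← dist_eq_norm, ← dist_eq_norm, ← dist_eq_norm, mul_add,
        mul_add, d₁, d₂, d₃, dist_comm (p v₁) (p w₁), dist_comm (p v₂) (p w₂),
        dist_comm (p v₃) (p w₃)]
      exact this)
  refine ⟨o, Set.mem_iInter₂.2 fun e hmem => ?_⟩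
  have := ho ⟨e, hmem⟩
  have h2 := he ⟨e, hmem⟩
  simp only at h2
  rw [h2]
  change dist o (m ⟨e, hmem⟩) ≤ r ⟨e, hmem⟩
  rw [dist_comm, dist_eq_norm]
  exact this
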